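/- Let $\mathbb T^2=\mathbb R^2/\mathbb Z^2$ be the flat torus, with geodesic distance $d$ and normalized Lebesgue measure (with respect to which all integrals over $\mathbb T^2$ are taken). For $L>0$ let $F_L:\mathbb T^2\to\mathbb T^2$ be the standard map with coefficient $L$, $$F_L(x,y)=\bigl(L\sin(2\pi x)+2x-y \ (\mathrm{mod}\ 1),\ x\bigr),$$ and let $F_L^n$ denote its $n$-th iterate. For $\alpha\in(0,1]$ and $\varphi:\mathbb T^2\to\mathbb R$ put $$\|\varphi\|_\alpha=\sup_{p}|\varphi(p)|+\sup_{p\ne q}\frac{|\varphi(p)-\varphi(q)|}{d(p,q)^\alpha}.$$ Theorem. For every $\alpha\in(0,1]$ there are constants $L_0''=L_0''(\alpha)>0$ and $C=C(\alpha)>0$, depending only on $\alpha$, such that for all $L\ge L_0''$, all $\alpha$-Hölder continuous functions $\varphi,\psi:\mathbb T^2\to\mathbb R$ and all integers $n\ge 2$, $$\left|\int \varphi\circ F_L^n\cdot\psi-\int\varphi\int\psi\right|\le C\,\|\varphi\|_\alpha\,\|\psi\|_\alpha\; n\,L^{-\frac{\alpha}{3\alpha+4}}.$$ -/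

import Mathlib

open MeasureTheory

noncomputable section

/-- The torus `𝕋² = ℝ²/ℤ²`. Its `volume` is the product of the Haar probability measures of the two
circle factors, i.e. normalized Lebesgue measure. -/
abbrev Torus : Type := UnitAddCircle × UnitAddCircle

/-- Geodesic distance of the flat torus `ℝ²/ℤ²`. The norm of an element of `UnitAddCircle` is the
distance of any representative to the nearest integer. -/
def torusDist (p q : Torus) : ℝ :=
  Real.sqrt (‖p.1 - q.1‖ ^ 2 + ‖p.2 - q.2‖ ^ 2)

/-- `φ` is `α`-Hölder continuous for the geodesic distance. -/
def IsHolder (α : ℝ) (φ : Torus → ℝ) : Prop :=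
  ∃ K : ℝ, ∀ p q : Torus, |φ p - φ q| ≤ K * torusDist p q ^ α

/-- Hölder modulus `[φ]_α`, the supremum of `|φ p - φ q| / d(p,q) ^ α`.
The diagonal pairs only contribute the value `0`. -/
def holderSeminorm (α : ℝ) (φ : Torus → ℝ) : ℝ :=
  ⨆ z : Torus × Torus, |φ z.1 - φ z.2| / torusDist z.1 z.2 ^ α

/-- Hölder norm `‖φ‖_α = ‖φ‖_{C⁰} + [φ]_α`. -/
def holderNorm (α : ℝ) (φ : Torus → ℝ) : ℝ :=
  (⨆ p : Torus, |φ p|) + holderSeminorm α φ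

theorem standardFun_periodic (L : ℝ) :
    Function.Periodic
      (fun x : ℝ => ((L * Real.sin (2 * Real.pi * x) + 2 * x : ℝ) : UnitAddCircle)) 1 := by
  intro x
  have h1 : Real.sin (2 * Real.pi * (x + 1)) = Real.sin (2 * Real.pi * x) := by
    rw [mul_add, mul_one, Real.sin_add_two_pi]
  have h2 : ((1 : ℝ) : UnitAddCircle) = 0 := AddCircle.coe_period 1
  simp only [h1]
  rw [show L * Real.sin (2 * Real.pi * x) + 2 * (x + 1)
      = L * Real.sin (2 * Real.pi * x) + 2 * x + 1 + 1 by ring]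
  simp only [AddCircle.coe_add, h2, add_zero]

/-- The circle map induced by `x ↦ L sin(2πx) + 2x (mod 1)`. -/
def standardFun (L : ℝ) : UnitAddCircle → UnitAddCircle :=
  (standardFun_periodic L).lift

/-- The standard map with coefficient `L`:
`F_L (x, y) = (L sin(2πx) + 2x - y (mod 1), x)`. -/
def standardMap (L : ℝ) (p : Torus) : Torus :=
  (standardFun L p.1 - p.2, p.1)

/-- In the coordinates `(x, p) = (x, x - y)` (a linear automorphism of the torus), `standardMap L`
is the Chirikov map `(x, p) ↦ (x + p', p')` with `p' = p + L sin(2πx)`. -/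
theorem standardMap_chirikov (L x y : ℝ) :
    let F := standardMap L ((x : UnitAddCircle), (y : UnitAddCircle))
    let p : ℝ := x - y
    let p' : ℝ := p + L * Real.sin (2 * Real.pi * x)
    (F.1, F.1 - F.2) = (((x + p' : ℝ) : UnitAddCircle), ((p' : ℝ) : UnitAddCircle)) := by
  intro F p p'
  have hF : F = (((L * Real.sin (2 * Real.pi * x) + 2 * x - y : ℝ) : UnitAddCircle),
      (x : UnitAddCircle)) := rfl
  rw [hF]
  simp only [Prod.mk.injEq, ← AddCircle.coe_sub]
  constructor <;> congr 1 <;> simp only [p, p'] <;> ring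

end

/-!
The correlations are estimated by integrating by parts along horizontal lines, the direction which
`F = standardMap L` expands.

Fix `y` and follow the line `x ↦ (x, y)`. Its `k`-th image is the curve `(Y_{k+1}, Y_k)`, where
`Y₀ = y`, `Y₁ = x` and `Y_{k+2} = f(Y_{k+1}) - Y_k` with `f(x) = L sin(2πx) + 2x`. As long as the
orbit keeps `|f'| ≥ 3K`, for a scale `1 ≪ K ≪ L`, the images stay nearly horizontal: their slopes
obey `R_{k+1} = 1 / (f'(Y_{k+1}) - R_k)`, hence `|R_k| ≲ 1 / K`. If `φ` has zero mean in `u` for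
each `v`, then `φ = ∂_u Φ` with `Φ` periodic, and
`φ(Y_{n+1}, Y_n) = (d/dx Φ(Y_{n+1}, Y_n) - Φ_v Y_n') / Y_{n+1}'`.
Integrating this against a density which is cut off where the orbit meets the strip `|f'| < 3K`
leaves the term with `Φ_v`, of size `1 / K` because `Y_n' / Y_{n+1}' = R_n`, and the derivative of
`weight`, the cut-off density divided by `Y_{n+1}'`. The latter is `O(1 / K + L / K²)` uniformly
in `n`, by a recursion in which each step contracts
(`abs_weight_mul_deriv_expansion_le`, `abs_deriv_weight_succ_le`). There are no boundary terms
since everything is periodic in `x`. This is `abs_integral_cutDensity_mul_le`.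

The strip has measure `O(K / L)` and `F` preserves the measure, so the cutoff removes mass
`O(n K / L)` in `n` steps; this is where the factor `n` comes from. Hölder observables are first
averaged over intervals of length `ε`, which costs `ε ^ α` and makes the relevant derivatives
`O(1 / ε)`. With `ε = L ^ (-1 / (3α + 4))` and `K = L ^ (1 - α / (3α + 4))` all errors are at most of
order `n L ^ (-α / (3α + 4))` (`exists_correlation_bound_of_mean_zero`).

For a general `φ` let `m(v)` be its mean over the horizontal circle at height `v`. Then
`φ - m(v)` has zero mean on horizontal circles, while `m(v) - ∫ φ` at time `n` is the function
`m(u) - ∫ φ` at time `n - 1`, which has zero mean in `u` too. The second function needs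
`n - 1 ≥ 1`, whence `n ≥ 2`.
-/

open MeasureTheory

noncomputable section

/-! ### Cutoff functions -/

/-- A `C¹` function equal to `1 / t` outside a compact interval is bounded, with bounded
derivative. -/
theorem exists_bound_of_eq_inv {f : ℝ → ℝ} (hf : ContDiff ℝ 1 f)
    (hinv : ∀ t, 2 ≤ |t| → f t = t⁻¹) :
    ∃ M : ℝ, (∀ t, |f t| ≤ M) ∧ ∀ t, |deriv f t| ≤ M := by
  obtain ⟨M₁, h₁⟩ := (isCompact_Icc (a := (-2 : ℝ)) (b := 2)).exists_bound_of_continuousOn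
    hf.continuous.continuousOn
  obtain ⟨M₂, h₂⟩ := (isCompact_Icc (a := (-2 : ℝ)) (b := 2)).exists_bound_of_continuousOn
    (hf.continuous_deriv le_rfl).continuousOn
  refine ⟨max 1 (max M₁ M₂), fun t => ?_, fun t => ?_⟩
  · rcases le_or_gt |t| 2 with ht | ht
    · exact (h₁ t (abs_le.1 ht)).trans ((le_max_left _ _).trans (le_max_right _ _))
    · rw [hinv t ht.le, abs_inv]
      exact (inv_le_one_of_one_le₀ (by linarith)).trans (le_max_left _ _)
  · rcases le_or_gt |t| 2 with ht | ht
    · exact (h₂ t (abs_le.1 ht)).trans ((le_max_right _ _).trans (le_max_right _ _))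
    · have hev : f =ᶠ[nhds t] fun s => s⁻¹ := by
        filter_upwards [(isOpen_lt continuous_const continuous_abs).mem_nhds ht] with s hs
        exact hinv s (le_of_lt hs)
      rw [hev.deriv_eq, deriv_inv, abs_neg, abs_inv, abs_pow]
      exact (inv_le_one_of_one_le₀ (by nlinarith)).trans (le_max_left _ _)

/-- A continuous cutoff `χ`, vanishing near the origin and equal to `1` far from it, and a `C¹`
function `h` which agrees with `t ↦ 1 / t` on the support of `χ`, both at scale `K`. -/
theorem exists_cutoff : ∃ M : ℝ, 1 ≤ M ∧ ∀ K : ℝ, 0 < K → ∃ χ h : ℝ → ℝ,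
    Continuous χ ∧ ContDiff ℝ 1 h ∧ ContDiff ℝ 1 (fun t => χ t * h t) ∧
    (∀ t, 0 ≤ χ t) ∧ (∀ t, χ t ≤ 1) ∧ (∀ t, 2 * K ≤ |t| → χ t = 1) ∧
    (∀ t, χ t * (h t * t) = χ t) ∧
    (∀ t, |h t| ≤ M / K) ∧ (∀ t, |deriv h t| ≤ M / K ^ 2) ∧
    (∀ t, |deriv (fun t => χ t * h t) t| ≤ M / K ^ 2) := by
  set χ₁ : ℝ → ℝ := fun t => Real.smoothTransition (t ^ 2 - 1) with hχ₁
  set h₁ : ℝ → ℝ := fun t => Real.smoothTransition (4 * t ^ 2 - 1) / t with hh₁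
  have cχ : ContDiff ℝ 1 χ₁ := Real.smoothTransition.contDiff.comp (by fun_prop)
  have ch : ContDiff ℝ 1 h₁ := by
    refine contDiff_iff_contDiffAt.2 fun t => ?_
    rcases eq_or_ne t 0 with rfl | ht
    · have : h₁ =ᶠ[nhds 0] fun _ => 0 := by
        have hc : Continuous fun s : ℝ => 4 * s ^ 2 := by fun_prop
        filter_upwards [(isOpen_lt hc continuous_const).mem_nhds
          (show 4 * (0 : ℝ) ^ 2 < 1 by norm_num)] with s hs
        have hs : 4 * s ^ 2 < 1 := hs
        simp only [hh₁]
        rw [Real.smoothTransition.zero_of_nonpos (by linarith), zero_div]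
      exact contDiffAt_const.congr_of_eventuallyEq this
    · exact (Real.smoothTransition.contDiff.comp (n := 1) (f := fun t : ℝ => 4 * t ^ 2 - 1)
        (by fun_prop)).contDiffAt.div contDiffAt_id ht
  have sq : ∀ t : ℝ, 2 ≤ |t| → 4 ≤ t ^ 2 := fun t ht => by nlinarith [sq_abs t]
  have hinv : ∀ t, 2 ≤ |t| → h₁ t = t⁻¹ := fun t ht => by
    simp only [hh₁]
    rw [Real.smoothTransition.one_of_one_le (by linarith [sq t ht]), one_div]
  have χone : ∀ t, 2 ≤ |t| → χ₁ t = 1 := fun t ht =>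
    Real.smoothTransition.one_of_one_le (by linarith [sq t ht])
  have χh : ∀ t, χ₁ t * (h₁ t * t) = χ₁ t := fun t => by
    rcases le_or_gt (t ^ 2) 1 with ht | ht
    · simp only [hχ₁]
      rw [Real.smoothTransition.zero_of_nonpos (by linarith), zero_mul]
    · simp only [hh₁]
      rw [Real.smoothTransition.one_of_one_le (by linarith), one_div, inv_mul_cancel₀, mul_one]
      rintro rfl
      norm_num at ht
  obtain ⟨M₁, b₁, b₁'⟩ := exists_bound_of_eq_inv ch hinv
  obtain ⟨M₂, -, b₂'⟩ := exists_bound_of_eq_inv (cχ.mul ch)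
    (fun t ht => by rw [χone t ht, hinv t ht, one_mul])
  have scale : ∀ (f : ℝ → ℝ) (K t : ℝ), ContDiff ℝ 1 f →
      deriv (fun t => f (t / K) / K) t = deriv f (t / K) / K ^ 2 := fun f K t hf => by
    have h1 : HasDerivAt f (deriv f (t / K)) (t / K) :=
      (hf.differentiable one_ne_zero).differentiableAt.hasDerivAt
    have := (h1.comp t ((hasDerivAt_id t).div_const K)).div_const K
    have e : deriv (fun t => f (t / K) / K) t = _ := HasDerivAt.deriv this
    rw [e]
    ring
  refine ⟨max 1 (max M₁ M₂), le_max_left _ _, fun K hK => ⟨fun t => χ₁ (t / K),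
    fun t => h₁ (t / K) / K, ?_, ?_, ?_, ?_, ?_, ?_, ?_, ?_, ?_, ?_⟩⟩
  · exact cχ.continuous.comp (by fun_prop)
  · exact (ch.comp (by fun_prop)).div_const K
  · exact (cχ.comp (by fun_prop)).mul ((ch.comp (by fun_prop)).div_const K)
  · exact fun t => Real.smoothTransition.nonneg _
  · exact fun t => Real.smoothTransition.le_one _
  · intro t ht
    refine χone _ ?_
    rwa [abs_div, abs_of_pos hK, le_div_iff₀ hK]
  · intro t
    have := χh (t / K)
    rw [show h₁ (t / K) / K * t = h₁ (t / K) * (t / K) by ring, this]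
  · intro t
    rw [abs_div, abs_of_pos hK]
    gcongr
    exact (b₁ _).trans ((le_max_left _ _).trans (le_max_right _ _))
  · intro t
    rw [scale h₁ K t ch, abs_div, abs_of_pos (pow_pos hK 2)]
    gcongr
    exact (b₁' _).trans ((le_max_left _ _).trans (le_max_right _ _))
  · intro t
    have e : (fun t => χ₁ (t / K) * (h₁ (t / K) / K))
        = fun t => (fun s => χ₁ s * h₁ s) (t / K) / K := by
      funext t; ring
    rw [e, scale _ K t (cχ.mul ch), abs_div, abs_of_pos (pow_pos hK 2)]
    gcongr
    exact (b₂' _).trans ((le_max_right _ _).trans (le_max_right _ _))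

/-! ### Orbits, slopes and weights along a horizontal line -/

/-- The derivative of `x ↦ L sin(2πx) + 2x`. -/
def stretch (L x : ℝ) : ℝ := L * (Real.cos (2 * Real.pi * x) * (2 * Real.pi)) + 2

/-- Lift to `ℝ` of the orbit of the point `(x, y)`, with indices shifted by one: the `k`-th iterate
of `(x, y)` under the standard map is `(orbit L y (k + 1) x, orbit L y k x)` modulo `1`. -/
def orbit (L y : ℝ) : ℕ → ℝ → ℝ
  | 0 => fun _ => y
  | 1 => fun x => x
  | k + 2 => fun x => L * Real.sin (2 * Real.pi * orbit L y (k + 1) x)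
      + 2 * orbit L y (k + 1) x - orbit L y k x

/-- Slope `dv / du` of the `k`-th image of the horizontal line at height `y`, in the coordinates
`(u, v)` of the torus. The inverse `t ↦ 1 / t` in the true recursion is replaced by a globally
defined function `h`, so that this is the slope only where the points have stayed away from the
critical strip. -/
def curveSlope (L y : ℝ) (h : ℝ → ℝ) : ℕ → ℝ → ℝ
  | 0 => fun _ => 0
  | k + 1 => fun x => h (stretch L (orbit L y (k + 1) x) - curveSlope L y h k x)

/-- One-step expansion factor along the `k`-th image of a horizontal line. -/
def expansion (L y : ℝ) (h : ℝ → ℝ) (k : ℕ) (x : ℝ) : ℝ :=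
  stretch L (orbit L y (k + 1) x) - curveSlope L y h k x

/-- The density `ρ`, cut off near the points which meet the critical strip before time `k`. -/
def cutDensity (L y : ℝ) (χ h ρ : ℝ → ℝ) : ℕ → ℝ → ℝ
  | 0 => ρ
  | k + 1 => fun x => cutDensity L y χ h ρ k x * χ (expansion L y h k x)

/-- The cut-off density divided by the accumulated expansion `d(orbit (k + 1)) / dx`. -/
def weight (L y : ℝ) (χ h ρ : ℝ → ℝ) : ℕ → ℝ → ℝ
  | 0 => ρ
  | k + 1 => fun x => weight L y χ h ρ k x
      * (χ (expansion L y h k x) * h (expansion L y h k x))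

theorem contDiff_stretch (L : ℝ) : ContDiff ℝ 1 (stretch L) := by
  unfold stretch; fun_prop

theorem contDiff_orbit (L y : ℝ) : ∀ k, ContDiff ℝ 1 (orbit L y k)
  | 0 => contDiff_const
  | 1 => contDiff_id
  | k + 2 => by
    have h1 := contDiff_orbit L y (k + 1)
    have h0 := contDiff_orbit L y k
    simp only [orbit]
    fun_prop

theorem deriv_orbit (L y : ℝ) (k : ℕ) (x : ℝ) : deriv (orbit L y (k + 2)) x
    = stretch L (orbit L y (k + 1) x) * deriv (orbit L y (k + 1)) x - deriv (orbit L y k) x := by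
  have h1 : HasDerivAt (orbit L y (k + 1)) (deriv (orbit L y (k + 1)) x) x :=
    ((contDiff_orbit L y (k + 1)).differentiable one_ne_zero).differentiableAt.hasDerivAt
  have h0 : HasDerivAt (orbit L y k) (deriv (orbit L y k) x) x :=
    ((contDiff_orbit L y k).differentiable one_ne_zero).differentiableAt.hasDerivAt
  have := ((((h1.const_mul (2 * Real.pi)).sin).const_mul L).add (h1.const_mul 2)).sub h0
  have e : deriv (orbit L y (k + 2)) x = _ := HasDerivAt.deriv (f := orbit L y (k + 2)) this
  rw [e, stretch]
  ring

theorem abs_deriv_stretch_le {L : ℝ} (hL : 0 ≤ L) (x : ℝ) : |deriv (stretch L) x| ≤ 40 * L := by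
  have h := ((((hasDerivAt_id x).const_mul (2 * Real.pi)).cos.mul_const
    (2 * Real.pi)).const_mul L).add_const 2
  have e : deriv (stretch L) x = _ := HasDerivAt.deriv (f := stretch L) h
  rw [e]
  have hs := Real.abs_sin_le_one (2 * Real.pi * x)
  simp only [id, mul_one]
  rw [show L * (-Real.sin (2 * Real.pi * x) * (2 * Real.pi) * (2 * Real.pi))
    = -(L * (2 * Real.pi) ^ 2 * Real.sin (2 * Real.pi * x)) by ring, abs_neg, abs_mul,
    abs_of_nonneg (by positivity)]
  have hp : (2 * Real.pi) ^ 2 ≤ 40 := by nlinarith [Real.pi_pos, Real.pi_lt_d2]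
  calc L * (2 * Real.pi) ^ 2 * |Real.sin (2 * Real.pi * x)|
      ≤ L * 40 * 1 := by gcongr
    _ = 40 * L := by ring

section Curve

variable {L y : ℝ} {χ h ρ : ℝ → ℝ}

theorem contDiff_curveSlope (ch : ContDiff ℝ 1 h) : ∀ k, ContDiff ℝ 1 (curveSlope L y h k)
  | 0 => contDiff_const
  | k + 1 => ch.comp (((contDiff_stretch L).comp (contDiff_orbit L y (k + 1))).sub
      (contDiff_curveSlope ch k))

theorem contDiff_expansion (ch : ContDiff ℝ 1 h) (k : ℕ) : ContDiff ℝ 1 (expansion L y h k) :=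
  ((contDiff_stretch L).comp (contDiff_orbit L y (k + 1))).sub (contDiff_curveSlope ch k)

theorem contDiff_weight (ch : ContDiff ℝ 1 h) (cg : ContDiff ℝ 1 (fun t => χ t * h t))
    (cρ : ContDiff ℝ 1 ρ) : ∀ k, ContDiff ℝ 1 (weight L y χ h ρ k)
  | 0 => cρ
  | k + 1 => (contDiff_weight ch cg cρ k).mul (cg.comp (contDiff_expansion ch k))

theorem continuous_cutDensity (cχ : Continuous χ) (ch : ContDiff ℝ 1 h) (cρ : Continuous ρ) :
    ∀ k, Continuous (cutDensity L y χ h ρ k)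
  | 0 => cρ
  | k + 1 => (continuous_cutDensity cχ ch cρ k).mul
      (cχ.comp (contDiff_expansion ch k).continuous)

/-- On the support of the cut-off density, `weight` is the density divided by the true derivative of
the orbit, and `curveSlope` is the true slope of the image curve. -/
theorem weight_mul_deriv_orbit (hχ : ∀ t, χ t * (h t * t) = χ t) (x : ℝ) (k : ℕ) :
    weight L y χ h ρ k x * deriv (orbit L y (k + 1)) x = cutDensity L y χ h ρ k x ∧
    weight L y χ h ρ k x * deriv (orbit L y k) x
      = cutDensity L y χ h ρ k x * curveSlope L y h k x := by
  induction k with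
  | zero =>
    have h1 : deriv (orbit L y 1) x = 1 := deriv_id x
    have h0 : deriv (orbit L y 0) x = 0 := deriv_const x y
    simp [h1, h0, weight, cutDensity, curveSlope]
  | succ k ih =>
    obtain ⟨i1, i2⟩ := ih
    have hχ := hχ (expansion L y h k x)
    have hs : curveSlope L y h (k + 1) x = h (expansion L y h k x) := rfl
    have ht : stretch L (orbit L y (k + 1) x) = expansion L y h k x + curveSlope L y h k x := by
      simp [expansion]
    constructor
    · rw [deriv_orbit, ht]
      simp only [weight, cutDensity]
      linear_combination (χ (expansion L y h k x) * h (expansion L y h k x)) *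
        ((expansion L y h k x + curveSlope L y h k x) * i1 - i2) + cutDensity L y χ h ρ k x * hχ
    · rw [hs]
      simp only [weight, cutDensity]
      linear_combination (χ (expansion L y h k x) * h (expansion L y h k x)) * i1

theorem abs_cutDensity_le {B : ℝ} (hχ0 : ∀ t, 0 ≤ χ t) (hχ1 : ∀ t, χ t ≤ 1)
    (hρ : ∀ x, |ρ x| ≤ B) (x : ℝ) : ∀ k, |cutDensity L y χ h ρ k x| ≤ B
  | 0 => hρ x
  | k + 1 => by
    simp only [cutDensity]
    rw [abs_mul, abs_of_nonneg (hχ0 _)]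
    exact (mul_le_of_le_one_right (abs_nonneg _) (hχ1 _)).trans
      (abs_cutDensity_le hχ0 hχ1 hρ x k)

/-- Distortion bound: along the image curves, the expansion factor varies at rate `O(L)`. -/
theorem abs_weight_mul_deriv_expansion_le {M K B : ℝ} (hL : 0 ≤ L) (hM : 1 ≤ M) (hK : 2 * M ≤ K)
    (ch : ContDiff ℝ 1 h)
    (hχ : ∀ t, χ t * (h t * t) = χ t) (hχ0 : ∀ t, 0 ≤ χ t) (hχ1 : ∀ t, χ t ≤ 1)
    (bh : ∀ t, |h t| ≤ M / K) (bh' : ∀ t, |deriv h t| ≤ M / K ^ 2)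
    (hρ : ∀ x, |ρ x| ≤ B) (x : ℝ) (k : ℕ) :
    |weight L y χ h ρ k x * deriv (expansion L y h k) x| ≤ 80 * L * B := by
  have hK0 : 0 < K := by linarith
  have hB : 0 ≤ B := (abs_nonneg _).trans (hρ 0)
  have dE : ∀ k, deriv (expansion L y h k) x
      = deriv (stretch L) (orbit L y (k + 1) x) * deriv (orbit L y (k + 1)) x
        - deriv (curveSlope L y h k) x := fun k => by
    have h1 := ((contDiff_orbit L y (k + 1)).differentiable one_ne_zero x).hasDerivAt
    have h2 := ((contDiff_stretch L).differentiable one_ne_zero (orbit L y (k + 1) x)).hasDerivAt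
    have h3 := ((contDiff_curveSlope (L := L) (y := y) ch k).differentiable one_ne_zero x).hasDerivAt
    exact HasDerivAt.deriv (f := expansion L y h k) ((h2.comp x h1).sub h3)
  have dS : ∀ k, deriv (curveSlope L y h (k + 1)) x
      = deriv h (expansion L y h k x) * deriv (expansion L y h k) x := fun k => by
    have h1 := ((contDiff_expansion (L := L) (y := y) ch k).differentiable
      one_ne_zero x).hasDerivAt
    have h2 := (ch.differentiable one_ne_zero (expansion L y h k x)).hasDerivAt
    exact HasDerivAt.deriv (f := curveSlope L y h (k + 1)) (h2.comp x h1)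
  have main : ∀ k, |deriv (stretch L) (orbit L y (k + 1) x) * cutDensity L y χ h ρ k x|
      ≤ 40 * L * B := fun k => by
    rw [abs_mul]
    exact mul_le_mul (abs_deriv_stretch_le hL _) (abs_cutDensity_le hχ0 hχ1 hρ x k)
      (abs_nonneg _) (by positivity)
  have split : ∀ k, weight L y χ h ρ k x * deriv (expansion L y h k) x
      = deriv (stretch L) (orbit L y (k + 1) x) * cutDensity L y χ h ρ k x
        - weight L y χ h ρ k x * deriv (curveSlope L y h k) x := fun k => by
    rw [dE, ← (weight_mul_deriv_orbit (L := L) (y := y) (ρ := ρ) hχ x k).1]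
    ring
  induction k with
  | zero =>
    have : deriv (curveSlope L y h 0) x = 0 := deriv_const x 0
    rw [split, this, mul_zero, sub_zero]
    refine (main 0).trans ?_
    nlinarith [mul_nonneg hL hB]
  | succ k ih =>
    rw [split, dS]
    refine (abs_sub _ _).trans ?_
    have e : weight L y χ h ρ (k + 1) x
        * (deriv h (expansion L y h k x) * deriv (expansion L y h k) x)
        = χ (expansion L y h k x) * h (expansion L y h k x) * deriv h (expansion L y h k x)
          * (weight L y χ h ρ k x * deriv (expansion L y h k) x) := by
      simp only [weight]; ring
    have hMK : M / K ≤ 1 / 2 := by rw [div_le_div_iff₀ hK0 two_pos]; linarith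
    have hMK2 : M / K ^ 2 ≤ 1 := by
      rw [div_le_one (by positivity)]; nlinarith
    have small : |χ (expansion L y h k x) * h (expansion L y h k x)
        * deriv h (expansion L y h k x)| ≤ 1 / 2 := by
      rw [abs_mul, abs_mul, abs_of_nonneg (hχ0 _)]
      calc χ (expansion L y h k x) * |h (expansion L y h k x)|
            * |deriv h (expansion L y h k x)|
          ≤ 1 * (1 / 2) * 1 := by
            gcongr
            · exact hχ1 _
            · exact (bh _).trans hMK
            · exact (bh' _).trans hMK2
        _ = 1 / 2 := by norm_num
    have h2 := mul_le_mul small ih (abs_nonneg _) (by norm_num)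
    rw [← abs_mul, ← e] at h2
    have := main (k + 1)
    linarith

/-- The derivative of the weight stays bounded uniformly in time: at each step the previous derivative
is multiplied by at most `M / K ≤ 1 / 2`, and the new contribution is controlled by the distortion
bound. -/
theorem abs_deriv_weight_succ_le {M K B B' : ℝ} (hL : 0 ≤ L) (hM : 1 ≤ M) (hK : 2 * M ≤ K)
    (ch : ContDiff ℝ 1 h) (cg : ContDiff ℝ 1 (fun t => χ t * h t)) (cρ : ContDiff ℝ 1 ρ)
    (hχ : ∀ t, χ t * (h t * t) = χ t) (hχ0 : ∀ t, 0 ≤ χ t) (hχ1 : ∀ t, χ t ≤ 1)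
    (bh : ∀ t, |h t| ≤ M / K) (bh' : ∀ t, |deriv h t| ≤ M / K ^ 2)
    (bg' : ∀ t, |deriv (fun t => χ t * h t) t| ≤ M / K ^ 2)
    (hρ : ∀ x, |ρ x| ≤ B) (hρ' : ∀ x, |deriv ρ x| ≤ B') (x : ℝ) (k : ℕ) :
    |deriv (weight L y χ h ρ (k + 1)) x| ≤ B' * (M / K) + 160 * L * B * (M / K ^ 2) := by
  have hK0 : 0 < K := by linarith
  have hB : 0 ≤ B := (abs_nonneg _).trans (hρ 0)
  have hB' : 0 ≤ B' := (abs_nonneg _).trans (hρ' 0)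
  have hMK : M / K ≤ 1 / 2 := by rw [div_le_div_iff₀ hK0 two_pos]; linarith
  have dW : ∀ k, deriv (weight L y χ h ρ (k + 1)) x
      = deriv (weight L y χ h ρ k) x * (χ (expansion L y h k x) * h (expansion L y h k x))
        + deriv (fun t => χ t * h t) (expansion L y h k x)
          * (weight L y χ h ρ k x * deriv (expansion L y h k) x) := fun k => by
    have h1 := ((contDiff_expansion (L := L) (y := y) ch k).differentiable
      one_ne_zero x).hasDerivAt
    have h2 := (cg.differentiable one_ne_zero (expansion L y h k x)).hasDerivAt
    have h3 := ((contDiff_weight (L := L) (y := y) ch cg cρ k).differentiable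
      one_ne_zero x).hasDerivAt
    have e : deriv (weight L y χ h ρ (k + 1)) x = _ :=
      HasDerivAt.deriv (f := weight L y χ h ρ (k + 1)) (h3.mul (h2.comp x h1))
    rw [e]
    ring
  have bg : ∀ t, |χ t * h t| ≤ M / K := fun t => by
    rw [abs_mul, abs_of_nonneg (hχ0 t)]
    exact (mul_le_of_le_one_left (abs_nonneg _) (hχ1 t)).trans (bh t)
  have step : ∀ k, |deriv (weight L y χ h ρ (k + 1)) x|
      ≤ |deriv (weight L y χ h ρ k) x| * (M / K) + M / K ^ 2 * (80 * L * B) := fun k => by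
    rw [dW]
    refine (abs_add_le _ _).trans ?_
    rw [abs_mul, abs_mul (deriv (fun t => χ t * h t) _)]
    gcongr
    · exact bg _
    · exact bg' _
    · exact abs_weight_mul_deriv_expansion_le hL hM hK ch hχ hχ0 hχ1 bh bh' hρ x k
  have hpos : 0 ≤ M / K ^ 2 * (80 * L * B) := by positivity
  have hpos' : 0 ≤ M / K := by positivity
  induction k with
  | zero =>
    have h0 : |deriv (weight L y χ h ρ 0) x| ≤ B' := hρ' x
    have := mul_le_mul_of_nonneg_right h0 hpos'
    linarith [step 0]
  | succ k ih =>
    have h1 := step (k + 1)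
    have h2 : |deriv (weight L y χ h ρ (k + 1)) x| * (M / K)
        ≤ (B' * (M / K) + 160 * L * B * (M / K ^ 2)) * (1 / 2) :=
      mul_le_mul ih hMK hpos' (by positivity)
    have : 0 ≤ B' * (M / K) := by positivity
    linarith

end Curve

/-! ### Box averages -/

/-- Average of `f` over the interval `[v, v + ε]`. -/
def boxAvg (ε : ℝ) (f : ℝ → ℝ) (v : ℝ) : ℝ := (∫ s in v..v + ε, f s) / ε

theorem hasDerivAt_boxAvg {f : ℝ → ℝ} (hf : Continuous f) (ε v : ℝ) :
    HasDerivAt (boxAvg ε f) ((f (v + ε) - f v) / ε) v := by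
  have hi : ∀ a b, IntervalIntegrable f volume a b := fun a b => hf.intervalIntegrable a b
  have h0 : HasDerivAt (fun u => ∫ s in (0 : ℝ)..u, f s) (f v) v :=
    intervalIntegral.integral_hasDerivAt_right (hi _ _) hf.aestronglyMeasurable.stronglyMeasurableAtFilter
      hf.continuousAt
  have h1 : HasDerivAt (fun u => ∫ s in (0 : ℝ)..u, f s) (f (v + ε)) (v + ε) :=
    intervalIntegral.integral_hasDerivAt_right (hi _ _) hf.aestronglyMeasurable.stronglyMeasurableAtFilter
      hf.continuousAt
  have h2 := ((h1.comp_add_const v ε).sub h0).div_const ε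
  refine h2.congr_of_eventuallyEq (Filter.Eventually.of_forall fun u => ?_)
  simp only [boxAvg, Pi.sub_apply]
  rw [intervalIntegral.integral_interval_sub_left (hi _ _) (hi _ _)]

theorem contDiff_boxAvg {f : ℝ → ℝ} (hf : Continuous f) (ε : ℝ) : ContDiff ℝ 1 (boxAvg ε f) := by
  rw [contDiff_one_iff_deriv]
  refine ⟨fun v => (hasDerivAt_boxAvg hf ε v).differentiableAt, ?_⟩
  have : deriv (boxAvg ε f) = fun v => (f (v + ε) - f v) / ε :=
    funext fun v => (hasDerivAt_boxAvg hf ε v).deriv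
  rw [this]
  fun_prop

theorem abs_boxAvg_le {f : ℝ → ℝ} {A ε : ℝ} (hε : 0 < ε) (hA : ∀ s, |f s| ≤ A) (v : ℝ) :
    |boxAvg ε f v| ≤ A := by
  rw [boxAvg, abs_div, abs_of_pos hε, div_le_iff₀ hε]
  have := intervalIntegral.norm_integral_le_of_norm_le_const (a := v) (b := v + ε) (f := f)
    (C := A) (fun x _ => hA x)
  rwa [add_sub_cancel_left, abs_of_pos hε] at this

theorem abs_boxAvg_slope_le {f : ℝ → ℝ} {A ε : ℝ} (hε : 0 < ε) (hA : ∀ s, |f s| ≤ A) (v : ℝ) :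
    |(f (v + ε) - f v) / ε| ≤ 2 * A / ε := by
  rw [abs_div, abs_of_pos hε]
  gcongr
  exact (abs_sub _ _).trans (by linarith [hA (v + ε), hA v])

theorem boxAvg_periodic {f : ℝ → ℝ} (hf : Function.Periodic f 1) (ε : ℝ) :
    Function.Periodic (boxAvg ε f) 1 := fun v => by
  simp only [boxAvg]
  rw [show v + 1 + ε = v + ε + 1 by ring,
    ← intervalIntegral.integral_comp_add_right (f := f) (d := 1)]
  simp only [hf _]

theorem abs_sub_boxAvg_le {f : ℝ → ℝ} (hf : Continuous f) {A α ε : ℝ} (hε : 0 < ε) (hα : 0 ≤ α)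
    (hA : 0 ≤ A) (hH : ∀ s t, |f s - f t| ≤ A * |s - t| ^ α) (v : ℝ) :
    |f v - boxAvg ε f v| ≤ A * ε ^ α := by
  have hi : IntervalIntegrable f volume v (v + ε) := hf.intervalIntegrable _ _
  have e : f v - boxAvg ε f v = (∫ s in v..v + ε, (f v - f s)) / ε := by
    rw [intervalIntegral.integral_sub intervalIntegrable_const hi,
      intervalIntegral.integral_const, boxAvg, add_sub_cancel_left, smul_eq_mul, sub_div,
      mul_div_cancel_left₀ _ hε.ne']
  rw [e, abs_div, abs_of_pos hε, div_le_iff₀ hε]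
  have := intervalIntegral.norm_integral_le_of_norm_le_const (a := v) (b := v + ε)
    (f := fun s => f v - f s) (C := A * ε ^ α) (fun s hs => by
      rw [Set.uIoc_of_le (by linarith)] at hs
      refine (hH v s).trans ?_
      gcongr
      rw [abs_le]; constructor <;> linarith [hs.1, hs.2])
  rwa [add_sub_cancel_left, abs_of_pos hε] at this

/-! ### Primitives in the expanding direction -/

theorem continuous_primitive {a : ℝ → ℝ → ℝ} (ha : Continuous (Function.uncurry a)) :
    Continuous fun p : ℝ × ℝ => ∫ t in (0 : ℝ)..p.1, a t p.2 := by
  have h2 : Continuous (Function.uncurry fun (p : ℝ × ℝ) (t : ℝ) => a t p.2) :=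
    ha.comp (by fun_prop : Continuous fun q : (ℝ × ℝ) × ℝ => (q.2, q.1.2))
  exact intervalIntegral.continuous_parametric_intervalIntegral_of_continuous h2 continuous_fst

theorem primitive_periodic {f : ℝ → ℝ} (hf : Continuous f) (hp : Function.Periodic f 1)
    (h0 : ∫ t in (0 : ℝ)..1, f t = 0) :
    Function.Periodic (fun u => ∫ t in (0 : ℝ)..u, f t) 1 := fun u => by
  have hi : ∀ a b, IntervalIntegrable f volume a b := fun a b => hf.intervalIntegrable a b
  change (∫ t in (0 : ℝ)..u + 1, f t) = ∫ t in (0 : ℝ)..u, f t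
  rw [← intervalIntegral.integral_add_adjacent_intervals (hi 0 u) (hi u (u + 1)),
    hp.intervalIntegral_add_eq u 0, zero_add, h0, add_zero]

theorem abs_primitive_le {f : ℝ → ℝ} {A : ℝ} (hf : Continuous f) (hp : Function.Periodic f 1)
    (h0 : ∫ t in (0 : ℝ)..1, f t = 0) (hA : ∀ t, |f t| ≤ A) (u : ℝ) :
    |∫ t in (0 : ℝ)..u, f t| ≤ A := by
  obtain ⟨w, hw, e⟩ := (primitive_periodic hf hp h0).exists_mem_Ico₀ one_pos u
  rw [e]
  have hA0 : 0 ≤ A := (abs_nonneg _).trans (hA 0)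
  have := intervalIntegral.norm_integral_le_of_norm_le_const (a := 0) (b := w)
    (f := f) (C := A) (fun s _ => hA s)
  rw [sub_zero, abs_of_nonneg hw.1] at this
  exact this.trans (mul_le_of_le_one_right hA0 hw.2.le)

/-- Primitive in the first variable of the average of `a` in the second variable. -/
def avgPrimitive (ε : ℝ) (a : ℝ → ℝ → ℝ) (u v : ℝ) : ℝ :=
  boxAvg ε (fun s => ∫ t in (0 : ℝ)..u, a t s) v

theorem continuous_uncurry_boxAvg {a : ℝ → ℝ → ℝ} (ha : Continuous (Function.uncurry a)) (ε : ℝ) :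
    Continuous fun p : ℝ × ℝ => boxAvg ε (a p.1) p.2 := by
  have e : (fun p : ℝ × ℝ => boxAvg ε (a p.1) p.2)
      = fun p : ℝ × ℝ => (∫ s in (0 : ℝ)..ε, a p.1 (s + p.2)) / ε := by
    funext p
    rw [boxAvg, intervalIntegral.integral_comp_add_right (fun s => a p.1 s), zero_add, add_comm]
  rw [e]
  have h2 : Continuous (Function.uncurry fun (p : ℝ × ℝ) (s : ℝ) => a p.1 (s + p.2)) :=
    ha.comp (by fun_prop : Continuous fun q : (ℝ × ℝ) × ℝ => (q.1.1, q.2 + q.1.2))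
  exact (intervalIntegral.continuous_parametric_intervalIntegral_of_continuous' h2 0 ε).div_const ε

/-- The average and the primitive are taken in different variables, so they commute. -/
theorem hasDerivAt_avgPrimitive_left {a : ℝ → ℝ → ℝ} (ha : Continuous (Function.uncurry a))
    (ε u v : ℝ) : HasDerivAt (fun u => avgPrimitive ε a u v) (boxAvg ε (a u) v) u := by
  have hc : Continuous fun t => boxAvg ε (a t) v :=
    (continuous_uncurry_boxAvg ha ε).comp (by fun_prop : Continuous fun t : ℝ => (t, v))
  have e : (fun u => avgPrimitive ε a u v) = fun u => ∫ t in (0 : ℝ)..u, boxAvg ε (a t) v := by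
    funext u
    simp only [avgPrimitive, boxAvg, intervalIntegral.integral_div]
    rw [intervalIntegral_intervalIntegral_swap]
    have hc2 : Continuous (Function.uncurry fun s t => a t s) :=
      ha.comp continuous_swap
    exact (hc2.continuousOn.integrableOn_compact (isCompact_uIcc.prod isCompact_uIcc)).mono_set
      (Set.prod_mono Set.uIoc_subset_uIcc Set.uIoc_subset_uIcc)
  rw [e]
  exact intervalIntegral.integral_hasDerivAt_right (hc.intervalIntegrable _ _)
    hc.aestronglyMeasurable.stronglyMeasurableAtFilter hc.continuousAt

theorem hasDerivAt_avgPrimitive_right {a : ℝ → ℝ → ℝ} (ha : Continuous (Function.uncurry a))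
    (ε u v : ℝ) : HasDerivAt (fun v => avgPrimitive ε a u v)
      (((∫ t in (0 : ℝ)..u, a t (v + ε)) - ∫ t in (0 : ℝ)..u, a t v) / ε) v :=
  hasDerivAt_boxAvg ((continuous_primitive ha).comp
    (by fun_prop : Continuous fun s : ℝ => (u, s))) ε v

/-- Chain rule for a function of two variables with continuous partial derivatives. -/
theorem hasDerivAt_comp_of_continuous_partials {Φ Φu Φv : ℝ → ℝ → ℝ}
    (hu : ∀ u v, HasDerivAt (fun u => Φ u v) (Φu u v) u)
    (hv : ∀ u v, HasDerivAt (fun v => Φ u v) (Φv u v) v)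
    (cu : Continuous (Function.uncurry Φu)) (cv : Continuous (Function.uncurry Φv))
    {p q : ℝ → ℝ} {p' q' x : ℝ} (hp : HasDerivAt p p' x) (hq : HasDerivAt q q' x) :
    HasDerivAt (fun x => Φ (p x) (q x)) (Φu (p x) (q x) * p' + Φv (p x) (q x) * q') x := by
  let T : ℝ →L[ℝ] ℝ →L[ℝ] ℝ := ContinuousLinearMap.toSpanSingletonCLE.toContinuousLinearMap
  have key := hasStrictFDerivAt_uncurry_coprod (𝕜 := ℝ) (u := (p x, q x)) (f := Φ)
    (f₁ := fun u v => T (Φu u v)) (f₂ := fun u v => T (Φv u v))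
    (Filter.Eventually.of_forall fun w => (hu w.1 w.2).hasFDerivAt)
    (Filter.Eventually.of_forall fun w => (hv w.1 w.2).hasFDerivAt)
    (T.continuous.comp cu).continuousAt (T.continuous.comp cv).continuousAt
  have h := key.hasFDerivAt.comp_hasDerivAt x (hp.prodMk hq)
  refine h.congr_deriv ?_
  simp [Function.HasUncurry.uncurry, T, mul_comm]

/-! ### The estimate along a horizontal line -/

section Line

variable {L y : ℝ} {χ h ρ : ℝ → ℝ}

/-- The weight takes the same value at both ends of the line `[0, 1]`, once the expansion factors
do. -/
theorem weight_congr (hper : ∀ k, stretch L (orbit L y (k + 1) 1) = stretch L (orbit L y (k + 1) 0))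
    (hρ : ρ 1 = ρ 0) (k : ℕ) : weight L y χ h ρ k 1 = weight L y χ h ρ k 0 := by
  have hs : ∀ k, curveSlope L y h k 1 = curveSlope L y h k 0 := by
    intro k
    induction k with
    | zero => rfl
    | succ k ih => simp only [curveSlope, ih, hper]
  induction k with
  | zero => exact hρ
  | succ k ih => simp only [weight, expansion, ih, hs, hper]

/-- Integration by parts along a horizontal line. The boundary terms cancel by periodicity. -/
theorem abs_integral_cutDensity_mul_le {M K B B' A A' : ℝ} (hL : 0 ≤ L) (hM : 1 ≤ M)
    (hK : 2 * M ≤ K) (cχ : Continuous χ)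
    (ch : ContDiff ℝ 1 h) (cg : ContDiff ℝ 1 (fun t => χ t * h t)) (cρ : ContDiff ℝ 1 ρ)
    (hχ : ∀ t, χ t * (h t * t) = χ t) (hχ0 : ∀ t, 0 ≤ χ t) (hχ1 : ∀ t, χ t ≤ 1)
    (bh : ∀ t, |h t| ≤ M / K) (bh' : ∀ t, |deriv h t| ≤ M / K ^ 2)
    (bg' : ∀ t, |deriv (fun t => χ t * h t) t| ≤ M / K ^ 2)
    (hρ : ∀ x, |ρ x| ≤ B) (hρ' : ∀ x, |deriv ρ x| ≤ B')
    (hper : ∀ k, stretch L (orbit L y (k + 1) 1) = stretch L (orbit L y (k + 1) 0))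
    (hρ1 : ρ 1 = ρ 0) {Φ Φu Φv : ℝ → ℝ → ℝ}
    (hu : ∀ u v, HasDerivAt (fun u => Φ u v) (Φu u v) u)
    (hv : ∀ u v, HasDerivAt (fun v => Φ u v) (Φv u v) v)
    (cu : Continuous (Function.uncurry Φu)) (cv : Continuous (Function.uncurry Φv))
    (bΦ : ∀ u v, |Φ u v| ≤ A) (bΦv : ∀ u v, |Φv u v| ≤ A') (k : ℕ)
    (hΦ1 : Φ (orbit L y (k + 2) 1) (orbit L y (k + 1) 1)
      = Φ (orbit L y (k + 2) 0) (orbit L y (k + 1) 0)) :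
    |∫ x in (0 : ℝ)..1, cutDensity L y χ h ρ (k + 1) x
        * Φu (orbit L y (k + 2) x) (orbit L y (k + 1) x)|
      ≤ B * (M / K) * A' + A * (B' * (M / K) + 160 * L * B * (M / K ^ 2)) := by
  have hK0 : 0 < K := by linarith
  have hA : 0 ≤ A := (abs_nonneg _).trans (bΦ 0 0)
  have hB : 0 ≤ B := (abs_nonneg _).trans (hρ 0)
  set P := cutDensity L y χ h ρ (k + 1)
  set W := weight L y χ h ρ (k + 1)
  set U := orbit L y (k + 2)
  set V := orbit L y (k + 1)
  set S := curveSlope L y h (k + 1)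
  have cU : ContDiff ℝ 1 U := contDiff_orbit L y (k + 2)
  have cV : ContDiff ℝ 1 V := contDiff_orbit L y (k + 1)
  have cW : ContDiff ℝ 1 W := contDiff_weight ch cg cρ (k + 1)
  have cP : Continuous P := continuous_cutDensity cχ ch cρ.continuous (k + 1)
  have cS : Continuous S := (contDiff_curveSlope ch (k + 1)).continuous
  have hd : ∀ x, HasDerivAt (fun x => Φ (U x) (V x) * W x)
      (P x * Φu (U x) (V x) + (P x * S x * Φv (U x) (V x) + Φ (U x) (V x) * deriv W x)) x := by
    intro x
    have h1 := hasDerivAt_comp_of_continuous_partials hu hv cu cv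
      (cU.differentiable one_ne_zero x).hasDerivAt (cV.differentiable one_ne_zero x).hasDerivAt
    have h2 := h1.mul (cW.differentiable one_ne_zero x).hasDerivAt
    obtain ⟨e1, e2⟩ := weight_mul_deriv_orbit (L := L) (y := y) (ρ := ρ) hχ x (k + 1)
    refine h2.congr_deriv ?_
    linear_combination Φu (U x) (V x) * e1 + Φv (U x) (V x) * e2
  have cΦ : Continuous fun x => Φ (U x) (V x) := continuous_iff_continuousAt.2 fun x =>
    (hasDerivAt_comp_of_continuous_partials hu hv cu cv
      (cU.differentiable one_ne_zero x).hasDerivAt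
      (cV.differentiable one_ne_zero x).hasDerivAt).continuousAt
  have cUV : Continuous fun x => (U x, V x) := cU.continuous.prodMk cV.continuous
  have c1 : Continuous fun x => P x * Φu (U x) (V x) := cP.mul (cu.comp cUV)
  have c2 : Continuous fun x => P x * S x * Φv (U x) (V x) + Φ (U x) (V x) * deriv W x :=
    ((cP.mul cS).mul (cv.comp cUV)).add (cΦ.mul (cW.continuous_deriv le_rfl))
  have ftc := intervalIntegral.integral_eq_sub_of_hasDerivAt (a := 0) (b := 1)
    (fun x _ => hd x) ((c1.add c2).intervalIntegrable 0 1)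
  have hW1 : W 1 = W 0 := weight_congr hper hρ1 (k + 1)
  rw [intervalIntegral.integral_add (c1.intervalIntegrable 0 1) (c2.intervalIntegrable 0 1),
    hΦ1, hW1, sub_self] at ftc
  rw [eq_neg_of_add_eq_zero_left ftc, abs_neg]
  have := intervalIntegral.norm_integral_le_of_norm_le_const (a := 0) (b := 1)
    (f := fun x => P x * S x * Φv (U x) (V x) + Φ (U x) (V x) * deriv W x)
    (C := B * (M / K) * A' + A * (B' * (M / K) + 160 * L * B * (M / K ^ 2))) (fun x _ => by
      refine (abs_add_le _ _).trans ?_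
      rw [abs_mul, abs_mul, abs_mul]
      gcongr
      · exact abs_cutDensity_le hχ0 hχ1 hρ x (k + 1)
      · exact bh _
      · exact bΦv _ _
      · exact bΦ _ _
      · exact abs_deriv_weight_succ_le hL hM hK ch cg cρ hχ hχ0 hχ1 bh bh' bg' hρ hρ' x k)
  simpa using this

end Line

/-! ### The standard map on the torus -/

theorem continuous_standardFun (L : ℝ) : Continuous (standardFun L) := by
  refine continuous_quot_lift _ ?_
  exact (AddCircle.continuous_mk' 1).comp (by fun_prop)

theorem continuous_standardMap (L : ℝ) : Continuous (standardMap L) :=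
  (((continuous_standardFun L).comp continuous_fst).sub continuous_snd).prodMk continuous_fst

theorem measurePreserving_standardMap (L : ℝ) : MeasurePreserving (standardMap L) := by
  have h := (MeasurePreserving.id (volume : Measure UnitAddCircle)).skew_product
    (μc := (volume : Measure UnitAddCircle)) (μd := (volume : Measure UnitAddCircle))
    (g := fun x y => standardFun L x - y)
    (((continuous_standardFun L).comp continuous_fst).sub continuous_snd).measurable
    (Filter.Eventually.of_forall fun x =>
      (Measure.measurePreserving_sub_left volume (standardFun L x)).map_eq)
  exact Measure.measurePreserving_swap.comp h

theorem standardMap_iterate_coe (L x y : ℝ) (k : ℕ) :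
    (standardMap L)^[k] ((x : UnitAddCircle), (y : UnitAddCircle))
      = ((orbit L y (k + 1) x : UnitAddCircle), (orbit L y k x : UnitAddCircle)) := by
  induction k with
  | zero => rfl
  | succ k ih => rw [Function.iterate_succ_apply', ih]; rfl

/-- Neighbourhood of size `δ` of the two zeros of `cos (2πx)` on the circle. -/
def criticalStrip (δ : ℝ) : Set UnitAddCircle :=
  {c | ‖(2 : ℕ) • c + ((1 / 2 : ℝ) : UnitAddCircle)‖ ≤ δ}

theorem isClosed_criticalStrip (δ : ℝ) : IsClosed (criticalStrip δ) :=
  isClosed_le (by fun_prop) continuous_const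

/-- The strip is the preimage of a ball under the measure preserving map `c ↦ 2c + 1 / 2`. -/
theorem volume_criticalStrip_le {δ : ℝ} (hδ : 0 ≤ δ) :
    (volume : Measure UnitAddCircle).real (criticalStrip δ) ≤ 2 * δ := by
  have e : criticalStrip δ = (fun c : UnitAddCircle =>
      (2 : ℕ) • c + ((1 / 2 : ℝ) : UnitAddCircle)) ⁻¹' Metric.closedBall 0 δ := by
    ext c; simp [criticalStrip]
  have mp : MeasurePreserving fun c : UnitAddCircle =>
      (2 : ℕ) • c + ((1 / 2 : ℝ) : UnitAddCircle) :=
    (AddCircle.ergodic_nsmul_add _ one_lt_two).toMeasurePreserving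
  rw [e, Measure.real, mp.measure_preimage Metric.isClosed_closedBall.nullMeasurableSet,
    AddCircle.volume_closedBall, ENNReal.toReal_ofReal (by positivity)]
  exact min_le_right _ _

/-- Jordan's inequality for `cos (2πx) = sin (π (2x + 1 / 2))`. -/
theorem two_mul_norm_le_abs_cos (x : ℝ) :
    2 * ‖((2 * x + 1 / 2 : ℝ) : UnitAddCircle)‖ ≤ |Real.cos (2 * Real.pi * x)| := by
  set t : ℝ := 2 * x + 1 / 2 with ht
  have e : |Real.cos (2 * Real.pi * x)| = |Real.sin (Real.pi * (t - round t))| := by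
    rw [← Real.sin_add_pi_div_two,
      show Real.pi * (t - round t) = (2 * Real.pi * x + Real.pi / 2) - (round t : ℤ) * Real.pi by
        rw [ht]; ring, Real.sin_sub_int_mul_pi, abs_mul]
    simp
  rw [e, UnitAddCircle.norm_eq]
  have hb : |Real.pi * (t - round t)| ≤ Real.pi / 2 := by
    rw [abs_mul, abs_of_pos Real.pi_pos]
    nlinarith [abs_sub_round t, Real.pi_pos]
  refine le_trans (le_of_eq ?_) (Real.mul_abs_le_abs_sin hb)
  rw [abs_mul, abs_of_pos Real.pi_pos]
  field_simp

theorem mem_criticalStrip {L K x : ℝ} (hL : 0 < L) (hK : 2 ≤ K) (hx : |stretch L x| ≤ 3 * K) :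
    (x : UnitAddCircle) ∈ criticalStrip (K / (2 * L)) := by
  have e : (2 : ℕ) • (x : UnitAddCircle) + ((1 / 2 : ℝ) : UnitAddCircle)
      = ((2 * x + 1 / 2 : ℝ) : UnitAddCircle) := by
    rw [two_nsmul, ← AddCircle.coe_add, ← AddCircle.coe_add, two_mul]
  have h := two_mul_norm_le_abs_cos x
  have h3 : L * |Real.cos (2 * Real.pi * x)| * (2 * Real.pi) ≤ 4 * K := by
    have : |L * (Real.cos (2 * Real.pi * x) * (2 * Real.pi))| ≤ 4 * K := by
      have h1 := abs_sub (stretch L x) 2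
      rw [stretch, add_sub_cancel_right] at h1
      rw [stretch] at hx
      rw [abs_two] at h1
      linarith
    rwa [abs_mul, abs_mul, abs_of_pos hL, abs_of_pos (by positivity : 0 < 2 * Real.pi),
      ← mul_assoc] at this
  have h4 : L * |Real.cos (2 * Real.pi * x)| ≤ K := by
    have : 0 ≤ L * |Real.cos (2 * Real.pi * x)| := by positivity
    nlinarith [Real.pi_gt_three]
  simp only [criticalStrip, Set.mem_ofPred_eq]
  rw [e, le_div_iff₀ (by positivity)]
  nlinarith

/-! ### Loss of mass at the critical strip -/

/-- The cutoff changes the density only along orbits which visit the critical strip. -/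
theorem abs_sub_cutDensity_le {L y K B : ℝ} {χ h ρ : ℝ → ℝ} (hL : 0 < L) (hK : 2 ≤ K)
    (hχ0 : ∀ t, 0 ≤ χ t) (hχ1 : ∀ t, χ t ≤ 1) (hχK : ∀ t, 2 * K ≤ |t| → χ t = 1)
    (hh : ∀ t, |h t| ≤ 1) (hρ : ∀ x, |ρ x| ≤ B) (x : ℝ) (n : ℕ) :
    |ρ x - cutDensity L y χ h ρ n x| ≤ B * ∑ j ∈ Finset.range n,
      (criticalStrip (K / (2 * L))).indicator 1 (orbit L y (j + 1) x : UnitAddCircle) := by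
  have hB : 0 ≤ B := (abs_nonneg _).trans (hρ 0)
  induction n with
  | zero => simp [cutDensity]
  | succ k ih =>
    rw [Finset.sum_range_succ, mul_add]
    set P := cutDensity L y χ h ρ k x with hP
    set T := expansion L y h k x with hT
    have e : ρ x - cutDensity L y χ h ρ (k + 1) x = (ρ x - P) + P * (1 - χ T) := by
      simp only [cutDensity, hP, hT]; ring
    rw [e]
    refine (abs_add_le _ _).trans (add_le_add ih ?_)
    by_cases hTK : 2 * K ≤ |T|
    · rw [hχK _ hTK, sub_self, mul_zero, abs_zero]
      exact mul_nonneg hB (Set.indicator_nonneg (fun _ _ => zero_le_one) _)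
    · have hS : |curveSlope L y h k x| ≤ 1 := by
        cases k with
        | zero => simp [curveSlope]
        | succ k => exact hh _
      have hmem : (orbit L y (k + 1) x : UnitAddCircle) ∈ criticalStrip (K / (2 * L)) := by
        refine mem_criticalStrip hL hK ?_
        have : stretch L (orbit L y (k + 1) x) = T + curveSlope L y h k x := by
          simp [hT, expansion]
        rw [this]
        exact (abs_add_le _ _).trans (by linarith [not_le.1 hTK])
      rw [Set.indicator_of_mem hmem, Pi.one_apply, mul_one, abs_mul]
      have h1 : |1 - χ T| ≤ 1 := by
        rw [abs_le]; constructor <;> linarith [hχ0 T, hχ1 T]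
      exact (mul_le_of_le_one_right (abs_nonneg _) h1).trans
        (abs_cutDensity_le hχ0 hχ1 hρ x k)

/-! ### Observables with zero mean in the expanding direction -/

theorem eq_of_coe_eq {f : ℝ → ℝ} (hf : Function.Periodic f 1) {u u' : ℝ}
    (hu : (u : UnitAddCircle) = u') : f u = f u' := by
  rw [← hf.lift_coe, ← hf.lift_coe, hu]

theorem periodic_comp_coe (g : UnitAddCircle → ℝ) : Function.Periodic (fun t : ℝ => g t) 1 :=
  fun t => congrArg g (AddCircle.coe_add_period 1 t)

theorem norm_coe_le_abs (s : ℝ) : ‖(s : UnitAddCircle)‖ ≤ |s| := by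
  rw [UnitAddCircle.norm_eq]
  simpa using round_le s 0

/-- Correlation along the horizontal line at height `y`: up to the time spent in the critical strip,
it is small by integration by parts. -/
theorem exists_abs_integral_line_le : ∃ M : ℝ, 1 ≤ M ∧ ∀ {L K ε α A B : ℝ} {φ ψ : Torus → ℝ},
    0 < L → 2 * M ≤ K → 0 < ε → 0 < α → Continuous φ → Continuous ψ →
    (∀ p, |φ p| ≤ A) → (∀ p, |ψ p| ≤ B) →
    (∀ c d d', |φ (c, d) - φ (c, d')| ≤ A * ‖d - d'‖ ^ α) →
    (∀ c c' d, |ψ (c, d) - ψ (c', d)| ≤ B * ‖c - c'‖ ^ α) →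
    (∀ d, ∫ c, φ (c, d) = 0) → ∀ (k : ℕ) (y : ℝ),
    |∫ x in (0 : ℝ)..1, φ ((standardMap L)^[k + 1] (x, y)) * ψ (x, y)|
      ≤ A * B * (2 * ε ^ α + M * (4 / (ε * K) + 160 * L / K ^ 2))
        + A * B * ∑ j ∈ Finset.range (k + 1), ∫ x in (0 : ℝ)..1,
            (criticalStrip (K / (2 * L))).indicator 1 ((standardMap L)^[j] (x, y)).1 := by
  obtain ⟨M, hM, hcut⟩ := exists_cutoff
  refine ⟨M, hM, ?_⟩
  intro L K ε α A B φ ψ hL hK hε hα cφ cψ bφ bψ hφ hψ hmean k y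
  have hK0 : 0 < K := by linarith
  have hA : 0 ≤ A := (abs_nonneg _).trans (bφ 0)
  have hB : 0 ≤ B := (abs_nonneg _).trans (bψ 0)
  obtain ⟨χ, h, cχ, ch, cg, hχ0, hχ1, hχK, hχ, bh, bh', bg'⟩ := hcut K hK0
  have ccoe : Continuous fun t : ℝ => (t : UnitAddCircle) := AddCircle.continuous_mk' 1
  set a : ℝ → ℝ → ℝ := fun u v => φ (u, v)
  have ca : Continuous (Function.uncurry a) :=
    cφ.comp ((ccoe.comp continuous_fst).prodMk (ccoe.comp continuous_snd))
  set f : ℝ → ℝ := fun x => ψ (x, y)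
  have cf : Continuous f := cψ.comp (ccoe.prodMk continuous_const)
  set ρ : ℝ → ℝ := boxAvg ε f
  set n := k + 1
  set P := cutDensity L y χ h ρ n
  set U := orbit L y (k + 2)
  set V := orbit L y (k + 1)
  set aε : ℝ → ℝ → ℝ := fun u v => boxAvg ε (a u) v
  have caε : Continuous (Function.uncurry aε) := continuous_uncurry_boxAvg ca ε
  have cρ : ContDiff ℝ 1 ρ := contDiff_boxAvg cf ε
  have bρ : ∀ x, |ρ x| ≤ B := abs_boxAvg_le hε fun s => bψ _
  have bρ' : ∀ x, |deriv ρ x| ≤ 2 * B / ε := fun x => by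
    rw [(hasDerivAt_boxAvg cf ε x).deriv]
    exact abs_boxAvg_slope_le (f := f) hε (fun s => bψ _) x
  have pa1 : ∀ v, Function.Periodic (fun u => a u v) 1 := fun v =>
    periodic_comp_coe fun c => φ (c, v)
  have pa2 : ∀ u, Function.Periodic (a u) 1 := fun u => periodic_comp_coe fun d => φ (u, d)
  have ca1 : ∀ v, Continuous fun u => a u v := fun v =>
    ca.comp (by fun_prop : Continuous fun u : ℝ => (u, v))
  have ca2 : ∀ u, Continuous (a u) := fun u =>
    ca.comp (by fun_prop : Continuous fun v : ℝ => (u, v))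
  have za : ∀ v, ∫ u in (0 : ℝ)..1, a u v = 0 := fun v => by
    have := UnitAddCircle.intervalIntegral_preimage 0 (fun c => φ (c, v))
    rw [zero_add] at this
    rw [this, hmean]
  -- the orbits of the two endpoints of the line coincide on the torus
  have hends : ∀ j, (orbit L y (j + 1) 1 : UnitAddCircle) = orbit L y (j + 1) 0 := fun j => by
    have h1 := standardMap_iterate_coe L 1 y j
    rw [show ((1 : ℝ) : UnitAddCircle) = ((0 : ℝ) : UnitAddCircle) by
      rw [AddCircle.coe_period, AddCircle.coe_zero], standardMap_iterate_coe L 0 y j] at h1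
    exact (congrArg Prod.fst h1).symm
  have hper : ∀ j, stretch L (orbit L y (j + 1) 1) = stretch L (orbit L y (j + 1) 0) :=
    fun j => eq_of_coe_eq (f := stretch L) (fun t => by
      simp only [stretch]
      rw [mul_add, mul_one, Real.cos_add_two_pi]) (hends j)
  have hρ1 : ρ 1 = ρ 0 := by
    have := boxAvg_periodic (periodic_comp_coe fun c => ψ (c, y)) ε 0
    rwa [zero_add] at this
  have bprim : ∀ u v, |∫ t in (0 : ℝ)..u, a t v| ≤ A := fun u v =>
    abs_primitive_le (ca1 v) (pa1 v) (za v) (fun t => bφ _) u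
  have hΦ1 : avgPrimitive ε a (U 1) (V 1) = avgPrimitive ε a (U 0) (V 0) := by
    trans avgPrimitive ε a (U 0) (V 1)
    · refine congrArg (fun g => boxAvg ε g (V 1)) (funext fun s => ?_)
      exact eq_of_coe_eq (primitive_periodic (ca1 s) (pa1 s) (za s)) (hends (k + 1))
    · refine eq_of_coe_eq (boxAvg_periodic (fun s => ?_) ε) (hends k)
      exact intervalIntegral.integral_congr fun t _ => pa2 t s
  have parts := abs_integral_cutDensity_mul_le (y := y) hL.le hM hK cχ ch cg cρ hχ hχ0 hχ1 bh bh'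
    bg' bρ bρ' hper hρ1 (hasDerivAt_avgPrimitive_left ca ε) (hasDerivAt_avgPrimitive_right ca ε)
    caε ?_ (fun u v => abs_boxAvg_le hε (bprim u) v)
    (fun u v => abs_boxAvg_slope_le hε (bprim u) v) k hΦ1
  swap
  · have c1 := continuous_primitive ca
    exact ((c1.comp (by fun_prop : Continuous fun p : ℝ × ℝ => (p.1, p.2 + ε))).sub c1).div_const ε
  have hh1 : ∀ t, |h t| ≤ 1 := fun t => (bh t).trans (by
    rw [div_le_one hK0]; linarith)
  set S : ℝ → ℝ := fun x => ∑ j ∈ Finset.range n,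
    (criticalStrip (K / (2 * L))).indicator 1 ((standardMap L)^[j] ((x : UnitAddCircle),
      (y : UnitAddCircle))).1 with hS
  have iS : ∀ j, IntervalIntegrable (fun x : ℝ => (criticalStrip (K / (2 * L))).indicator
      (1 : UnitAddCircle → ℝ) ((standardMap L)^[j] ((x : UnitAddCircle),
      (y : UnitAddCircle))).1) volume 0 1 := fun j => by
    have cj : Continuous fun x : ℝ => ((standardMap L)^[j] ((x : UnitAddCircle),
      (y : UnitAddCircle))).1 :=
      continuous_fst.comp (((continuous_standardMap L).iterate j).comp
        (ccoe.prodMk continuous_const))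
    have hm : Measurable fun x : ℝ => (criticalStrip (K / (2 * L))).indicator
        (1 : UnitAddCircle → ℝ) ((standardMap L)^[j] ((x : UnitAddCircle),
        (y : UnitAddCircle))).1 :=
      (measurable_one.indicator (isClosed_criticalStrip _).measurableSet).comp cj.measurable
    refine (intervalIntegrable_const (c := (1 : ℝ))).mono_fun hm.aestronglyMeasurable
      (Filter.Eventually.of_forall fun x => ?_)
    refine (norm_indicator_le_norm_self _ _).trans ?_
    simp
  have cUV : Continuous fun x => (U x, V x) :=
    (contDiff_orbit L y _).continuous.prodMk (contDiff_orbit L y _).continuous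
  have cP : Continuous P := continuous_cutDensity cχ ch cρ.continuous n
  have c1 : Continuous fun x => a (U x) (V x) * f x := (ca.comp cUV).mul cf
  have c2 : Continuous fun x => P x * aε (U x) (V x) := cP.mul (caε.comp cUV)
  have pt : ∀ x, |a (U x) (V x) * f x - P x * aε (U x) (V x)|
      ≤ A * B * (2 * ε ^ α) + A * B * S x := fun x => by
    -- the three errors: smoothing of `ψ`, cutoff, smoothing of `φ`
    have e : a (U x) (V x) * f x - P x * aε (U x) (V x)
        = a (U x) (V x) * (f x - ρ x) + a (U x) (V x) * (ρ x - P x)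
          + P x * (a (U x) (V x) - aε (U x) (V x)) := by ring
    have h1 : |f x - ρ x| ≤ B * ε ^ α := abs_sub_boxAvg_le cf hε hα.le hB (fun s t => by
      refine (hψ _ _ _).trans ?_
      rw [← AddCircle.coe_sub]
      gcongr
      exact norm_coe_le_abs _) x
    have h2 : |ρ x - P x| ≤ B * S x := by
      have := abs_sub_cutDensity_le (y := y) hL (by linarith) hχ0 hχ1 hχK hh1 bρ x n
      simpa only [hS, standardMap_iterate_coe] using this
    have h3 : |a (U x) (V x) - aε (U x) (V x)| ≤ A * ε ^ α :=
      abs_sub_boxAvg_le (ca2 _) hε hα.le hA (fun s t => by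
        refine (hφ _ _ _).trans ?_
        rw [← AddCircle.coe_sub]
        gcongr
        exact norm_coe_le_abs _) (V x)
    rw [e]
    refine (abs_add_le _ _).trans ((add_le_add_left (abs_add_le _ _) _).trans ?_)
    rw [abs_mul, abs_mul, abs_mul]
    have hp1 := mul_le_mul (bφ ((U x : UnitAddCircle), (V x : UnitAddCircle))) h1
      (abs_nonneg _) hA
    have hp2 := mul_le_mul (bφ ((U x : UnitAddCircle), (V x : UnitAddCircle))) h2
      (abs_nonneg _) hA
    have hp3 := mul_le_mul (abs_cutDensity_le (L := L) (y := y) (h := h) hχ0 hχ1 bρ x n) h3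
      (abs_nonneg _) hB
    linarith
  have eI : ∫ x in (0 : ℝ)..1, φ ((standardMap L)^[k + 1] (x, y)) * ψ (x, y)
      = (∫ x in (0 : ℝ)..1, (a (U x) (V x) * f x - P x * aε (U x) (V x)))
        + ∫ x in (0 : ℝ)..1, P x * aε (U x) (V x) := by
    have c12 : Continuous fun x => a (U x) (V x) * f x - P x * aε (U x) (V x) := c1.sub c2
    rw [← intervalIntegral.integral_add (c12.intervalIntegrable 0 1)
      (c2.intervalIntegrable 0 1)]
    simp only [sub_add_cancel, standardMap_iterate_coe]
    rfl
  have iSum : IntervalIntegrable S volume 0 1 := by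
    have := IntervalIntegrable.sum (Finset.range n) fun j _ => iS j
    simpa only [hS, Finset.sum_fn] using this
  have bI : |∫ x in (0 : ℝ)..1, (a (U x) (V x) * f x - P x * aε (U x) (V x))|
      ≤ A * B * (2 * ε ^ α) + A * B * ∫ x in (0 : ℝ)..1, S x := by
    have := intervalIntegral.norm_integral_le_of_norm_le (μ := volume)
      (f := fun x => a (U x) (V x) * f x - P x * aε (U x) (V x))
      (g := fun x => A * B * (2 * ε ^ α) + A * B * S x) zero_le_one
      (Filter.Eventually.of_forall fun x _ => pt x)
      (intervalIntegrable_const.add (iSum.const_mul (A * B)))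
    refine this.trans (le_of_eq ?_)
    rw [intervalIntegral.integral_add intervalIntegrable_const (iSum.const_mul (A * B)),
      intervalIntegral.integral_const_mul]
    simp
  have eS : ∫ x in (0 : ℝ)..1, S x = ∑ j ∈ Finset.range n, ∫ x in (0 : ℝ)..1,
      (criticalStrip (K / (2 * L))).indicator 1 ((standardMap L)^[j] (x, y)).1 :=
    intervalIntegral.integral_finsetSum fun j _ => iS j
  rw [eI]
  refine (abs_add_le _ _).trans ((add_le_add bI parts).trans (le_of_eq ?_))
  rw [eS]
  field_simp
  ring

/-! ### Correlations on the torus -/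

instance isProbabilityMeasure_unitAddCircle :
    IsProbabilityMeasure (volume : Measure UnitAddCircle) :=
  ⟨UnitAddCircle.measure_univ⟩

theorem integrable_torus_of_continuous {f : Torus → ℝ} (hf : Continuous f) : Integrable f :=
  hf.integrable_of_hasCompactSupport (HasCompactSupport.of_compactSpace f)

theorem integral_indicator_iterate_le (L : ℝ) {δ : ℝ} (hδ : 0 ≤ δ) (j : ℕ) :
    ∫ p : Torus, (criticalStrip δ).indicator (1 : UnitAddCircle → ℝ) ((standardMap L)^[j] p).1
      ≤ 2 * δ := by
  have mp : MeasurePreserving (fun p : Torus => ((standardMap L)^[j] p).1) :=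
    measurePreserving_fst.comp ((measurePreserving_standardMap L).iterate j)
  have hm := (isClosed_criticalStrip δ).measurableSet
  have e : (fun p : Torus => (criticalStrip δ).indicator (1 : UnitAddCircle → ℝ)
      ((standardMap L)^[j] p).1)
      = ((fun p : Torus => ((standardMap L)^[j] p).1) ⁻¹' criticalStrip δ).indicator 1 := by
    funext p; rfl
  rw [e, integral_indicator_one (mp.measurable hm), Measure.real,
    mp.measure_preimage hm.nullMeasurableSet]
  exact volume_criticalStrip_le hδ

/-- The correlation of `ψ` with an observable `φ` of zero mean on each horizontal circle. The scales
`K` (expansion required along orbits) and `ε` (smoothing of the observables) are free. -/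
theorem exists_abs_integral_comp_iterate_le : ∃ M : ℝ, 1 ≤ M ∧
    ∀ {L K ε α A B : ℝ} {φ ψ : Torus → ℝ},
    0 < L → 2 * M ≤ K → 0 < ε → 0 < α → Continuous φ → Continuous ψ →
    (∀ p, |φ p| ≤ A) → (∀ p, |ψ p| ≤ B) →
    (∀ c d d', |φ (c, d) - φ (c, d')| ≤ A * ‖d - d'‖ ^ α) →
    (∀ c c' d, |ψ (c, d) - ψ (c', d)| ≤ B * ‖c - c'‖ ^ α) →
    (∀ d, ∫ c, φ (c, d) = 0) → ∀ k : ℕ,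
    |∫ p : Torus, φ ((standardMap L)^[k + 1] p) * ψ p|
      ≤ A * B * (2 * ε ^ α + M * (4 / (ε * K) + 160 * L / K ^ 2))
        + A * B * ((k + 1 : ℕ) * (K / L)) := by
  obtain ⟨M, hM, hline⟩ := exists_abs_integral_line_le
  refine ⟨M, hM, ?_⟩
  intro L K ε α A B φ ψ hL hK hε hα cφ cψ bφ bψ hφ hψ hmean k
  have hA : 0 ≤ A := (abs_nonneg _).trans (bφ 0)
  have hB : 0 ≤ B := (abs_nonneg _).trans (bψ 0)
  have hK0 : 0 < K := by linarith
  set c₀ := A * B * (2 * ε ^ α + M * (4 / (ε * K) + 160 * L / K ^ 2)) with hc₀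
  set I : ℕ → Torus → ℝ := fun j p =>
    (criticalStrip (K / (2 * L))).indicator 1 ((standardMap L)^[j] p).1 with hI
  have hIm : ∀ j, Measurable (I j) := fun j =>
    (measurable_one.indicator (isClosed_criticalStrip _).measurableSet).comp
      (measurable_fst.comp ((continuous_standardMap L).iterate j).measurable)
  have hIi : ∀ j, Integrable (I j) := fun j =>
    (integrable_const (1 : ℝ)).mono' (hIm j).aestronglyMeasurable
      (Filter.Eventually.of_forall fun p => by
        refine (norm_indicator_le_norm_self _ _).trans ?_
        simp)
  have hG : Continuous fun p : Torus => φ ((standardMap L)^[k + 1] p) * ψ p :=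
    (cφ.comp ((continuous_standardMap L).iterate (k + 1))).mul cψ
  have circle : ∀ g : UnitAddCircle → ℝ, ∫ x in (0 : ℝ)..1, g x = ∫ c, g c := fun g => by
    have := UnitAddCircle.intervalIntegral_preimage 0 g
    rwa [zero_add] at this
  have slice : ∀ d : UnitAddCircle,
      ‖∫ c : UnitAddCircle, φ ((standardMap L)^[k + 1] (c, d)) * ψ (c, d)‖
        ≤ c₀ + A * B * ∑ j ∈ Finset.range (k + 1), ∫ c, I j (c, d) := by
    intro d
    obtain ⟨y, rfl⟩ := QuotientAddGroup.mk_surjective d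
    have := hline hL hK hε hα cφ cψ bφ bψ hφ hψ hmean k y
    rw [circle fun c => φ ((standardMap L)^[k + 1] (c, (y : UnitAddCircle))) * ψ (c, y)] at this
    refine this.trans (le_of_eq ?_)
    congr 2
    exact Finset.sum_congr rfl fun j _ => circle fun c => I j (c, (y : UnitAddCircle))
  have hsi : ∀ j, Integrable fun d : UnitAddCircle => ∫ c, I j (c, d) := fun j =>
    (hIi j).integral_prod_right
  have hsum : Integrable fun d : UnitAddCircle =>
      ∑ j ∈ Finset.range (k + 1), ∫ c, I j (c, d) := integrable_finsetSum _ fun j _ => hsi j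
  have hswap := integral_prod_symm (μ := (volume : Measure UnitAddCircle))
    (ν := (volume : Measure UnitAddCircle)) _ (integrable_torus_of_continuous hG)
  have e : ∫ p : Torus, φ ((standardMap L)^[k + 1] p) * ψ p
      = ∫ d, ∫ c, φ ((standardMap L)^[k + 1] (c, d)) * ψ (c, d) := hswap
  rw [e]
  refine (norm_integral_le_of_norm_le ((integrable_const c₀).add (hsum.const_mul (A * B)))
    (Filter.Eventually.of_forall slice)).trans ?_
  have eint : ∫ d : UnitAddCircle, (c₀ + A * B * ∑ j ∈ Finset.range (k + 1), ∫ c, I j (c, d))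
      = c₀ + A * B * ∑ j ∈ Finset.range (k + 1), ∫ d, ∫ c, I j (c, d) := by
    rw [integral_add (integrable_const c₀) (hsum.const_mul (A * B)),
      integral_const_mul (A * B) fun d : UnitAddCircle =>
        ∑ j ∈ Finset.range (k + 1), ∫ c, I j (c, d),
      integral_finsetSum _ fun j _ => hsi j]
    simp
  refine eint.trans_le ?_
  have hj : ∀ j, ∫ d, ∫ c, I j (c, d) ≤ K / L := fun j => by
    have h1 : ∫ p : Torus, I j p = ∫ d, ∫ c, I j (c, d) :=
      integral_prod_symm (μ := (volume : Measure UnitAddCircle))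
        (ν := (volume : Measure UnitAddCircle)) _ (hIi j)
    rw [← h1]
    refine (integral_indicator_iterate_le L (by positivity) j).trans (le_of_eq ?_)
    field_simp
  have hs := Finset.sum_le_card_nsmul (Finset.range (k + 1)) (fun j => ∫ d, ∫ c, I j (c, d))
    (K / L) fun j _ => hj j
  rw [Finset.card_range, nsmul_eq_mul] at hs
  have := mul_le_mul_of_nonneg_left hs (mul_nonneg hA hB)
  linarith

/-- The choice `K = L ^ (1 - α / (3α + 4))`, `ε = L ^ (-1 / (3α + 4))` of the scales. Only the smoothing
error and the measure of the critical strip are then of the order of the bound. -/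
theorem exists_correlation_bound_of_mean_zero (α : ℝ) (hα : 0 < α) : ∃ L₀ : ℝ, 0 < L₀ ∧
    ∃ C : ℝ, 0 < C ∧ ∀ {L A B : ℝ} {φ ψ : Torus → ℝ},
    L₀ ≤ L → Continuous φ → Continuous ψ → (∀ p, |φ p| ≤ A) → (∀ p, |ψ p| ≤ B) →
    (∀ c d d', |φ (c, d) - φ (c, d')| ≤ A * ‖d - d'‖ ^ α) →
    (∀ c c' d, |ψ (c, d) - ψ (c', d)| ≤ B * ‖c - c'‖ ^ α) →
    (∀ d, ∫ c, φ (c, d) = 0) → ∀ k : ℕ,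
    |∫ p : Torus, φ ((standardMap L)^[k + 1] p) * ψ p|
      ≤ C * A * B * (((k + 1 : ℕ) : ℝ) * L ^ (-(α / (3 * α + 4)))) := by
  obtain ⟨M, hM, hcorr⟩ := exists_abs_integral_comp_iterate_le
  refine ⟨(2 * M) ^ 2, by positivity, 3 + 164 * M, by positivity, ?_⟩
  intro L A B φ ψ hL cφ cψ bφ bψ hφ hψ hmean k
  have hA : 0 ≤ A := (abs_nonneg _).trans (bφ 0)
  have hB : 0 ≤ B := (abs_nonneg _).trans (bψ 0)
  have hL1 : 1 ≤ L := by nlinarith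
  have hL0 : 0 < L := by linarith
  set γ := 1 / (3 * α + 4) with hγ
  set β := α / (3 * α + 4) with hβ
  have hden : 0 < 3 * α + 4 := by positivity
  have hβγ : γ * α = β := by rw [hγ, hβ]; ring
  have hβ3 : 3 * β ≤ 1 := by
    rw [hβ, ← mul_div_assoc, div_le_one hden]; linarith
  have hγβ : γ + 2 * β ≤ 1 := by
    rw [hγ, hβ, ← mul_div_assoc, ← add_div, div_le_one hden]; linarith
  have hK : 2 * M ≤ L ^ (1 - β) := by
    calc 2 * M = ((2 * M) ^ 2 : ℝ) ^ (1 / 2 : ℝ) := by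
          rw [← Real.sqrt_eq_rpow, Real.sqrt_sq (by positivity)]
      _ ≤ L ^ (1 / 2 : ℝ) := by gcongr
      _ ≤ L ^ (1 - β) := Real.rpow_le_rpow_of_exponent_le hL1 (by linarith)
  have main := hcorr (ε := L ^ (-γ)) hL0 hK (by positivity) hα cφ cψ bφ bψ hφ hψ hmean k
  have e1 : (L ^ (-γ)) ^ α = L ^ (-β) := by
    rw [← Real.rpow_mul hL0.le, neg_mul, hβγ]
  have e2 : 4 / (L ^ (-γ) * L ^ (1 - β)) ≤ 4 * L ^ (-β) := by
    rw [← Real.rpow_add hL0, div_eq_mul_inv, ← Real.rpow_neg hL0.le]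
    refine mul_le_mul_of_nonneg_left ?_ (by norm_num)
    exact Real.rpow_le_rpow_of_exponent_le hL1 (by linarith)
  have e3 : 160 * L / (L ^ (1 - β)) ^ 2 ≤ 160 * L ^ (-β) := by
    have : L / (L ^ (1 - β)) ^ 2 = L ^ (1 - (1 - β) * 2) := by
      rw [Real.rpow_sub hL0 1 ((1 - β) * 2), Real.rpow_one, Real.rpow_mul hL0.le, Real.rpow_two]
    rw [mul_div_assoc, this]
    refine mul_le_mul_of_nonneg_left ?_ (by norm_num)
    exact Real.rpow_le_rpow_of_exponent_le hL1 (by linarith)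
  have e4 : L ^ (1 - β) / L = L ^ (-β) := by
    rw [← Real.rpow_sub_one hL0.ne']; congr 1; ring
  rw [e1, e4] at main
  refine main.trans ?_
  set X := L ^ (-β)
  have hX : 0 ≤ X := by positivity
  have hn : (1 : ℝ) ≤ ((k + 1 : ℕ) : ℝ) := by exact_mod_cast Nat.succ_le_succ (Nat.zero_le k)
  set n : ℝ := ((k + 1 : ℕ) : ℝ)
  have h5 : 2 * X + M * (4 / (L ^ (-γ) * L ^ (1 - β)) + 160 * L / (L ^ (1 - β)) ^ 2)
      ≤ (2 + 164 * M) * (n * X) := by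
    have h6 : M * (4 / (L ^ (-γ) * L ^ (1 - β)) + 160 * L / (L ^ (1 - β)) ^ 2)
        ≤ M * (4 * X + 160 * X) := by gcongr
    have h7 : (2 + 164 * M) * X ≤ (2 + 164 * M) * (n * X) := by
      gcongr
      exact le_mul_of_one_le_left hX hn
    linarith
  have h8 := mul_le_mul_of_nonneg_left h5 (mul_nonneg hA hB)
  calc _ ≤ A * B * ((2 + 164 * M) * (n * X)) + A * B * (n * X) := by gcongr
    _ = _ := by ring

/-! ### Hölder observables -/

theorem IsHolder.continuous {α : ℝ} (hα : 0 < α) {φ : Torus → ℝ} (hφ : IsHolder α φ) :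
    Continuous φ := by
  obtain ⟨K, hK⟩ := hφ
  refine continuous_iff_continuousAt.2 fun q => ?_
  rw [ContinuousAt, tendsto_iff_norm_sub_tendsto_zero]
  have hd : Continuous fun p => K * torusDist p q ^ α := by
    unfold torusDist
    exact continuous_const.mul ((by fun_prop : Continuous fun p : Torus =>
      Real.sqrt (‖p.1 - q.1‖ ^ 2 + ‖p.2 - q.2‖ ^ 2)).rpow_const fun _ => Or.inr hα.le)
  have h0 : K * torusDist q q ^ α = 0 := by
    simp [torusDist, Real.zero_rpow hα.ne']
  refine squeeze_zero (fun _ => norm_nonneg _) (fun p => hK p q) ?_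
  rw [← h0]
  exact hd.tendsto q

theorem torusDist_nonneg (p q : Torus) : 0 ≤ torusDist p q := Real.sqrt_nonneg _

theorem IsHolder.bddAbove_quotient {α : ℝ} {φ : Torus → ℝ} (hφ : IsHolder α φ) :
    BddAbove (Set.range fun z : Torus × Torus =>
      |φ z.1 - φ z.2| / torusDist z.1 z.2 ^ α) := by
  obtain ⟨K, hK⟩ := hφ
  refine ⟨max K 0, ?_⟩
  rintro _ ⟨z, rfl⟩
  have hd : 0 ≤ torusDist z.1 z.2 ^ α := Real.rpow_nonneg (torusDist_nonneg _ _) _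
  exact div_le_of_le_mul₀ hd (le_max_right _ _) ((hK _ _).trans
    (mul_le_mul_of_nonneg_right (le_max_left _ _) hd))

theorem IsHolder.abs_le_holderNorm {α : ℝ} (hα : 0 < α) {φ : Torus → ℝ} (hφ : IsHolder α φ)
    (p : Torus) : |φ p| ≤ holderNorm α φ := by
  have h1 : |φ p| ≤ ⨆ p, |φ p| := le_ciSup
    (isCompact_range (hφ.continuous hα).abs).bddAbove p
  have h2 : 0 ≤ holderSeminorm α φ := Real.iSup_nonneg fun z =>
    div_nonneg (abs_nonneg _) (Real.rpow_nonneg (torusDist_nonneg _ _) _)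
  exact h1.trans (le_add_of_nonneg_right h2)

/-- This includes pairs at distance zero, on which the quotient in `holderSeminorm` is `0 / 0 = 0`. -/
theorem IsHolder.abs_sub_le_holderNorm {α : ℝ} (hα : 0 < α) {φ : Torus → ℝ} (hφ : IsHolder α φ)
    (p q : Torus) : |φ p - φ q| ≤ holderNorm α φ * torusDist p q ^ α := by
  rcases (torusDist_nonneg p q).eq_or_lt with h0 | hpos
  · obtain ⟨K, hK⟩ := hφ
    have := hK p q
    rw [← h0, Real.zero_rpow hα.ne', mul_zero] at this ⊢
    exact this
  · rw [← div_le_iff₀ (Real.rpow_pos_of_pos hpos α)]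
    have h1 := le_ciSup hφ.bddAbove_quotient (p, q)
    have h2 : 0 ≤ ⨆ p, |φ p| := Real.iSup_nonneg fun p => abs_nonneg _
    exact h1.trans (le_add_of_nonneg_left h2)

theorem torusDist_vertical (c d d' : UnitAddCircle) : torusDist (c, d) (c, d') = ‖d - d'‖ := by
  simp [torusDist, Real.sqrt_sq]

theorem torusDist_horizontal (c c' d : UnitAddCircle) :
    torusDist (c, d) (c', d) = ‖c - c'‖ := by
  simp [torusDist, Real.sqrt_sq]

/-! ### Decay of correlations -/

theorem theoremD (α : ℝ) (hα0 : 0 < α) (hα1 : α ≤ 1) :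
    ∃ L₀ : ℝ, 0 < L₀ ∧ ∃ C : ℝ, 0 < C ∧
      ∀ L : ℝ, L₀ ≤ L → ∀ φ ψ : Torus → ℝ, IsHolder α φ → IsHolder α ψ →
        ∀ n : ℕ, 2 ≤ n →
          |(∫ p : Torus, φ ((standardMap L)^[n] p) * ψ p)
              - (∫ p : Torus, φ p) * (∫ p : Torus, ψ p)|
            ≤ C * holderNorm α φ * holderNorm α ψ * ((n : ℝ) * L ^ (-(α / (3 * α + 4)))) := by
  obtain ⟨L₀, hL₀, C, hC, hcorr⟩ := exists_correlation_bound_of_mean_zero α hα0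
  refine ⟨L₀, hL₀, 4 * C, by positivity, fun L hL φ ψ hφ hψ n hn => ?_⟩
  obtain ⟨k, rfl⟩ : ∃ k, n = k + 1 + 1 := ⟨n - 2, by omega⟩
  set A := holderNorm α φ
  set B := holderNorm α ψ
  have cφ := hφ.continuous hα0
  have cψ := hψ.continuous hα0
  have bφ : ∀ p, |φ p| ≤ A := hφ.abs_le_holderNorm hα0
  have bψ : ∀ p, |ψ p| ≤ B := hψ.abs_le_holderNorm hα0
  have hA : 0 ≤ A := (abs_nonneg _).trans (bφ 0)
  have hB : 0 ≤ B := (abs_nonneg _).trans (bψ 0)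
  have hψ' : ∀ c c' d, |ψ (c, d) - ψ (c', d)| ≤ B * ‖c - c'‖ ^ α := fun c c' d => by
    rw [← torusDist_horizontal c c' d]; exact hψ.abs_sub_le_holderNorm hα0 _ _
  have hφ' : ∀ c d d', |φ (c, d) - φ (c, d')| ≤ A * ‖d - d'‖ ^ α := fun c d d' => by
    rw [← torusDist_vertical c d d']; exact hφ.abs_sub_le_holderNorm hα0 _ _
  have icirc : ∀ {g : UnitAddCircle → ℝ}, Continuous g → Integrable g := fun hg =>
    hg.integrable_of_hasCompactSupport (HasCompactSupport.of_compactSpace _)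
  -- averages of `φ` over horizontal circles
  set m : UnitAddCircle → ℝ := fun d => ∫ c, φ (c, d) with hm
  have cs : ∀ d, Continuous fun c : UnitAddCircle => φ (c, d) := fun d =>
    cφ.comp (by fun_prop)
  have cm : Continuous m := by
    refine continuous_of_dominated (bound := fun _ => A)
      (fun d => (cs d).aestronglyMeasurable) (fun d => Filter.Eventually.of_forall fun c => bφ _)
      (integrable_const A) (Filter.Eventually.of_forall fun c => cφ.comp (by fun_prop))
  have bm : ∀ d, |m d| ≤ A := fun d => by
    have := norm_integral_le_of_norm_le (μ := volume) (f := fun c => φ (c, d)) (integrable_const A)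
      (Filter.Eventually.of_forall fun c => bφ (c, d))
    simpa using this
  have hm' : ∀ d d', |m d - m d'| ≤ A * ‖d - d'‖ ^ α := fun d d' => by
    have e : m d - m d' = ∫ c, (φ (c, d) - φ (c, d')) :=
      (integral_sub (icirc (cs d)) (icirc (cs d'))).symm
    rw [e]
    have := norm_integral_le_of_norm_le (μ := volume) (f := fun c => φ (c, d) - φ (c, d')) (integrable_const (A * ‖d - d'‖ ^ α))
      (Filter.Eventually.of_forall fun c => hφ' c d d')
    simpa using this
  set J := ∫ p : Torus, φ p with hJ
  have eJ : ∫ d, m d = J :=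
    (integral_prod_symm (μ := (volume : Measure UnitAddCircle))
      (ν := (volume : Measure UnitAddCircle)) _ (integrable_torus_of_continuous cφ)).symm
  have bJ : |J| ≤ A := by
    have := norm_integral_le_of_norm_le (μ := volume) (f := φ) (integrable_const A)
      (Filter.Eventually.of_forall fun p : Torus => bφ p)
    simpa using this
  have hX : 0 ≤ L ^ (-(α / (3 * α + 4))) := Real.rpow_nonneg (hL₀.le.trans hL) _
  set X := L ^ (-(α / (3 * α + 4)))
  have c1 : Continuous fun p : Torus => φ p - m p.2 := cφ.sub (cm.comp continuous_snd)
  have c2 : Continuous fun p : Torus => m p.1 - J := (cm.comp continuous_fst).sub continuous_const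
  have h1 := hcorr (A := 2 * A) (φ := fun p => φ p - m p.2) hL c1 cψ
    (fun p => (abs_sub _ _).trans (by linarith [bφ p, bm p.2])) bψ
    (fun c d d' => by
      rw [show φ (c, d) - m d - (φ (c, d') - m d')
        = (φ (c, d) - φ (c, d')) - (m d - m d') by ring]
      exact (abs_sub _ _).trans (by linarith [hφ' c d d', hm' d d'])) hψ'
    (fun d => by
      change ∫ c, (φ (c, d) - m d) = 0
      rw [integral_sub (icirc (cs d)) (integrable_const _)]
      simp [hm]) (k + 1)
  -- `m` at height `v` only sees the first coordinate of the previous iterate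
  have h2 := hcorr (A := 2 * A) (φ := fun p => m p.1 - J) hL c2 cψ
    (fun p => (abs_sub _ _).trans (by linarith [bm p.1])) bψ
    (fun c d d' => by
      rw [sub_self, abs_zero]; positivity) hψ'
    (fun d => by
      rw [integral_sub (icirc cm) (integrable_const _), eJ]
      simp) k
  have ci : ∀ j, Continuous (standardMap L)^[j] := fun j => (continuous_standardMap L).iterate j
  have i1 : Integrable fun p : Torus => (φ ((standardMap L)^[k + 1 + 1] p)
      - m ((standardMap L)^[k + 1 + 1] p).2) * ψ p :=
    integrable_torus_of_continuous ((c1.comp (ci (k + 1 + 1))).mul cψ)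
  have i2 : Integrable fun p : Torus => (m ((standardMap L)^[k + 1] p).1 - J) * ψ p :=
    integrable_torus_of_continuous ((c2.comp (ci (k + 1))).mul cψ)
  have i3 := (integrable_torus_of_continuous cψ).const_mul J
  have split : ∫ p : Torus, φ ((standardMap L)^[k + 1 + 1] p) * ψ p
      = (∫ p : Torus, (φ ((standardMap L)^[k + 1 + 1] p)
            - m ((standardMap L)^[k + 1 + 1] p).2) * ψ p)
        + (∫ p : Torus, (m ((standardMap L)^[k + 1] p).1 - J) * ψ p)
        + J * ∫ p : Torus, ψ p := by
    have i12 : Integrable fun p : Torus => (φ ((standardMap L)^[k + 1 + 1] p)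
        - m ((standardMap L)^[k + 1 + 1] p).2) * ψ p
        + (m ((standardMap L)^[k + 1] p).1 - J) * ψ p := i1.add i2
    rw [← integral_const_mul, ← integral_add i1 i2, ← integral_add i12 i3]
    refine integral_congr_ae (Filter.Eventually.of_forall fun p => ?_)
    have e : ((standardMap L)^[k + 1 + 1] p).2 = ((standardMap L)^[k + 1] p).1 := by
      rw [Function.iterate_succ_apply']; rfl
    simp only [e]
    ring
  rw [split, add_sub_cancel_right]
  refine (abs_add_le _ _).trans ((add_le_add h1 h2).trans ?_)
  have hk : C * (2 * A) * B * (((k + 1 : ℕ) : ℝ) * X)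
      ≤ C * (2 * A) * B * (((k + 1 + 1 : ℕ) : ℝ) * X) := by
    gcongr
    exact Nat.le_succ _
  linarith

end
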